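/- Let $M$ be a set of $n$ men and $W$ a set of $n$ women, where every man has a preference list (a strict total order) over $W$ and every woman has a preference list over $M$; let $\succ$ denote the resulting preference profile. For a profile $\succ$, let $\mathrm{DA}(\succ)$ be the perfect matching computed by the men-proposing deferred acceptance algorithm: in each round every currently unmatched man proposes to his favorite woman among those who have not rejected him yet, every woman then tentatively accepts her favorite proposal received so far and rejects the others, and the algorithm stops when no further proposals can be made. Fix a woman $w \in W$, and let $(\succ_{-w}, L)$ denote the profile obtained from $\succ$ by replacing $w$'s list $\succ_w$ by the list $L$. Let $$S_w := \{ (m_i, m_j, \succ_w \setminus \{m_i, m_j\}) : m_i, m_j \in M,\ m_i \neq m_j \}$$ be the set of lists obtained from $\succ_w$ by moving some two men to the top two positions, in either order, and leaving the relative order of all other men unchanged (if $n = 1$, then $S_w := \{\succ_w\}$). Lemma. For every preference list $\succ'_w$ over $M$ (an arbitrary misreport by $w$), there is a list $\succ''_w \in S_w$ such that $$\mathrm{DA}(\succ_{-w}, \succ''_w) = \mathrm{DA}(\succ_{-w}, \succ'_w).$$ -/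

import Mathlib

/-- A preference list over a finite set `α` : a strict total order on `α`, written as the list of all
elements of `α`, each exactly once, from the most preferred to the least preferred one. -/
@[ext]
structure PrefList (α : Type*) where
  toList : List α
  nodup : toList.Nodup
  complete : ∀ a, a ∈ toList

/-- The most preferred element, with respect to `L`, of the set of all `a` with `p a`
(`none` if there is no such `a`). -/
def PrefList.favorite {α : Type*} (L : PrefList α) (p : α → Prop) [DecidablePred p] : Option α :=
  L.toList.find? (fun a => decide (p a))

/-- A preference profile: one preference list over the women for every man, and one preference list
over the men for every woman. -/
structure PrefProfile (M W : Type*) where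
  men : M → PrefList W
  women : W → PrefList M

/-- The profile in which woman `w` submits the list `L` and everybody else's list is unchanged. -/
def PrefProfile.replaceWoman {M W : Type*} [DecidableEq W] (P : PrefProfile M W) (w : W)
    (L : PrefList M) : PrefProfile M W where
  men := P.men
  women := Function.update P.women w L

/-- The lists `(p, q, L \ {p, q})`, obtained from `L` by moving a pair of men `p`, `q` to the top two
positions (in this order) and leaving the relative order of all the others unchanged.
The two men are distinct, except that if there is only one man, then `p = q` is allowed and
the result is the one-element list. -/
def topTwoLists {M : Type*} [Fintype M] [DecidableEq M] (L : PrefList M) : Set (PrefList M) :=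
  {L' | ∃ p q : M, (2 ≤ Fintype.card M → p ≠ q) ∧
    L'.toList = [p, q].dedup ++ L.toList.filter (fun m => decide (m ≠ p ∧ m ≠ q))}

namespace DeferredAcceptance

/-! The state of the men-proposing deferred acceptance algorithm is the set `S` of all proposals
`(m, w)` (man `m` has proposed to woman `w`) that have been made so far. -/

variable {M W : Type*} [Fintype M] [Fintype W] [DecidableEq M] [DecidableEq W]

/-- The man who is tentatively accepted by `w`: her favorite among all the men who have proposed
to her so far. -/
def holds (P : PrefProfile M W) (S : Finset (M × W)) (w : W) : Option M :=
  (P.women w).favorite (fun m => (m, w) ∈ S)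

/-- `w` has rejected `m`: he has proposed to her and is not the man whom she holds. -/
def Rejected (P : PrefProfile M W) (S : Finset (M × W)) (m : M) (w : W) : Prop :=
  (m, w) ∈ S ∧ holds P S w ≠ some m

/-- No woman currently holds `m`. -/
def Unmatched (P : PrefProfile M W) (S : Finset (M × W)) (m : M) : Prop :=
  ∀ w, holds P S w ≠ some m

instance (P : PrefProfile M W) (S : Finset (M × W)) (m : M) :
    DecidablePred (fun w => ¬ Rejected P S m w) :=
  fun w => inferInstanceAs (Decidable (¬ ((m, w) ∈ S ∧ holds P S w ≠ some m)))

instance (P : PrefProfile M W) (S : Finset (M × W)) : DecidablePred (Unmatched P S) :=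
  fun m => inferInstanceAs (Decidable (∀ w, holds P S w ≠ some m))

/-- The proposals of the next proposal phase: every currently unmatched man proposes to his favorite
woman among those who have not rejected him yet. -/
def newProposals (P : PrefProfile M W) (S : Finset (M × W)) : Finset (M × W) :=
  Finset.univ.filter (fun x => Unmatched P S x.1 ∧
    (P.men x.1).favorite (fun w => ¬ Rejected P S x.1 w) = some x.2)

/-- The set of proposals made during the first `k` rounds. -/
def proposalsAfter (P : PrefProfile M W) : ℕ → Finset (M × W)
  | 0 => ∅
  | k + 1 => proposalsAfter P k ∪ newProposals P (proposalsAfter P k)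

theorem mem_newProposals {P : PrefProfile M W} {S : Finset (M × W)} {m : M} {w : W} :
    (m, w) ∈ newProposals P S ↔ Unmatched P S m ∧
      (P.men m).favorite (fun w => ¬ Rejected P S m w) = some w := by
  simp [newProposals]

theorem not_mem_of_mem_newProposals {P : PrefProfile M W} {S : Finset (M × W)} {x : M × W}
    (hx : x ∈ newProposals P S) : x ∉ S := by
  obtain ⟨m, w⟩ := x
  obtain ⟨hu, hf⟩ := mem_newProposals.1 hx
  have h := List.find?_some hf
  intro hS
  simp only [decide_eq_true_eq] at h
  exact h ⟨hS, hu w⟩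

/-- The algorithm terminates: after finitely many rounds there is no further proposal. -/
theorem exists_newProposals_eq_empty (P : PrefProfile M W) :
    ∃ k, newProposals P (proposalsAfter P k) = ∅ := by
  by_contra! h
  have key : ∀ k, k ≤ (proposalsAfter P k).card := by
    intro k
    induction k with
    | zero => simp
    | succ k ih =>
      have hd : Disjoint (proposalsAfter P k) (newProposals P (proposalsAfter P k)) :=
        Finset.disjoint_right.2 fun x hx => not_mem_of_mem_newProposals hx
      have hpos := Finset.card_pos.2 (h k)
      rw [proposalsAfter, Finset.card_union_of_disjoint hd]
      omega
  have h1 := key (Fintype.card (M × W) + 1)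
  have h2 := Finset.card_le_univ (proposalsAfter P (Fintype.card (M × W) + 1))
  omega

/-- The set of all proposals made during the run of the algorithm on the profile `P`, which ends
as soon as no further proposal can be made. -/
def finalProposals (P : PrefProfile M W) : Finset (M × W) :=
  proposalsAfter P (Nat.find (exists_newProposals_eq_empty P))

theorem newProposals_finalProposals (P : PrefProfile M W) :
    newProposals P (finalProposals P) = ∅ :=
  Nat.find_spec (exists_newProposals_eq_empty P)

theorem mem_of_holds {P : PrefProfile M W} {S : Finset (M × W)} {m : M} {w : W}
    (h : holds P S w = some m) : (m, w) ∈ S := by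
  simpa using List.find?_some h

theorem holds_of_subset {P : PrefProfile M W} {S T : Finset (M × W)} (hST : S ⊆ T) {m : M} {w : W}
    (h : holds P T w = some m) (hm : (m, w) ∈ S) : holds P S w = some m := by
  unfold holds PrefList.favorite at h ⊢
  rw [List.find?_eq_some_iff_append] at h ⊢
  obtain ⟨_, as, bs, h2, h3⟩ := h
  refine ⟨by simpa using hm, as, bs, h2, fun a ha => ?_⟩
  have := h3 a ha
  simp only [Bool.not_eq_true', decide_eq_false_iff_not] at this ⊢
  exact fun hS => this (hST hS)

theorem holds_injective_after (P : PrefProfile M W) (k : ℕ) {m : M} {w w' : W}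
    (h : holds P (proposalsAfter P k) w = some m) (h' : holds P (proposalsAfter P k) w' = some m) :
    w = w' := by
  induction k with
  | zero => simpa [proposalsAfter] using mem_of_holds h
  | succ k ih =>
    have hsub : proposalsAfter P k ⊆ proposalsAfter P (k + 1) := Finset.subset_union_left
    rcases Finset.mem_union.1 (mem_of_holds h) with h1 | h1 <;>
      rcases Finset.mem_union.1 (mem_of_holds h') with h2 | h2
    · exact ih (holds_of_subset hsub h h1) (holds_of_subset hsub h' h2)
    · exact absurd (holds_of_subset hsub h h1) ((mem_newProposals.1 h2).1 w)
    · exact absurd (holds_of_subset hsub h' h2) ((mem_newProposals.1 h1).1 w')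
    · exact Option.some.inj ((mem_newProposals.1 h1).2.symm.trans (mem_newProposals.1 h2).2)

/-- When the algorithm ends, every man is held by some woman, provided that there are as many men as
women. -/
theorem exists_holds_finalProposals (hcard : Fintype.card M = Fintype.card W)
    (P : PrefProfile M W) (m : M) : ∃ w, holds P (finalProposals P) w = some m := by
  by_contra! hm
  have hrej : ∀ w, Rejected P (finalProposals P) m w := by
    intro w
    by_contra hw
    cases hf : (P.men m).favorite (fun w => ¬ Rejected P (finalProposals P) m w) with
    | none =>
      have := List.find?_eq_none.1 hf w ((P.men m).complete w)
      simp only [decide_eq_true_eq] at this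
      exact this hw
    | some v =>
      have hv : (m, v) ∈ newProposals P (finalProposals P) := mem_newProposals.2 ⟨hm, hf⟩
      rw [newProposals_finalProposals] at hv
      simp at hv
  have hheld : ∀ w, ∃ m', holds P (finalProposals P) w = some m' := by
    intro w
    cases hf : holds P (finalProposals P) w with
    | none =>
      have := List.find?_eq_none.1 hf m ((P.women w).complete m)
      simp only [decide_eq_true_eq] at this
      exact absurd (hrej w).1 this
    | some v => exact ⟨v, rfl⟩
  choose f hf using hheld
  have hinj : Function.Injective f := fun w w' hww =>
    holds_injective_after P _ (hf w) (hww ▸ hf w')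
  obtain ⟨w, hw⟩ := ((Fintype.bijective_iff_injective_and_card f).2 ⟨hinj, hcard.symm⟩).2 m
  exact hm w (hw ▸ hf w)

/-- The woman to whom the algorithm assigns the man `m`: the one who holds him at the end. -/
noncomputable def partner (hcard : Fintype.card M = Fintype.card W) (P : PrefProfile M W)
    (m : M) : W :=
  (exists_holds_finalProposals hcard P m).choose

theorem holds_partner (hcard : Fintype.card M = Fintype.card W) (P : PrefProfile M W) (m : M) :
    holds P (finalProposals P) (partner hcard P m) = some m :=
  (exists_holds_finalProposals hcard P m).choose_spec

theorem partner_bijective (hcard : Fintype.card M = Fintype.card W) (P : PrefProfile M W) :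
    Function.Bijective (partner hcard P) := by
  refine (Fintype.bijective_iff_injective_and_card _).2 ⟨fun m m' h => ?_, hcard⟩
  have h1 := holds_partner hcard P m
  rw [h, holds_partner hcard P m'] at h1
  exact (Option.some.inj h1).symm

end DeferredAcceptance

/-- The matching computed by the men-proposing deferred acceptance algorithm on the profile `P`, as
a bijection from the men to the women: `m` is matched to the woman who holds him at the end. -/
noncomputable def deferredAcceptance {M W : Type*} [Fintype M] [Fintype W] [DecidableEq M]
    [DecidableEq W] (hcard : Fintype.card M = Fintype.card W) (P : PrefProfile M W) : M ≃ W :=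
  Equiv.ofBijective (DeferredAcceptance.partner hcard P)
    (DeferredAcceptance.partner_bijective hcard P)

/-!
Let `L'` be the misreport of `w`, let `p` and `x` be her favorite and second favorite, with respect
to `L'`, among the men who propose to her under `L'`, and let `L` be her true list with `p` and `x`
moved to the top. The proposals made under a profile form a least fixed point, and if the men's
lists are fixed, they determine the matching; so it is enough that the same proposals are made
under `L` and `L'`.

All men who propose to `w` under `L'` except `p` are rejected in favor of `p`, so `L` causes no
additional proposals. Conversely, as soon as `p` or `x` proposes to `w` under `L`, she rejects every
other man whom she rejects under `L'`, and no proposals are lost. The remaining point is that `p` or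
`x` does propose. Let `w` instead reject exactly those of her proposers under `L'` that are neither
`p` nor `x`. Then both `p` and `x` propose to her, because until the second of them arrives she
rejects everybody whom she rejects under `L'`. She thus ends up with two men, so some other woman is
left without a proposal. If neither `p` nor `x` proposed to `w` under `L`, then all proposals made
under `L` would be made here too, although under `L` every woman receives one.
-/

namespace PrefList

variable {α : Type*} [DecidableEq α]

/-- The strict total order encoded by a preference list: `a` stands above `b`. -/
def Prefers (L : PrefList α) (a b : α) : Prop :=
  L.toList.idxOf a < L.toList.idxOf b

/-- `a` is the top element of the set `X` with respect to `L`; the relational counterpart of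
`PrefList.favorite`. -/
def IsFavorite (L : PrefList α) (X : Set α) (a : α) : Prop :=
  a ∈ X ∧ ∀ b ∈ X, ¬ L.Prefers b a

/-- `p` is the favorite in `X` and `x` the second favorite. If `p` is the only element of `X`, then
`x` is arbitrary. -/
def IsTopTwo (L : PrefList α) (X : Set α) (p x : α) : Prop :=
  L.IsFavorite X p ∧ ((X \ {p}).Nonempty → L.IsFavorite (X \ {p}) x)

/-- The rejections made by an agent with preference list `L`, as a function of the set `X` of
proposers: everybody but her favorite. -/
def outranked (L : PrefList α) : Set α →o Set α where
  toFun X := {a ∈ X | ∃ b ∈ X, L.Prefers b a}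
  monotone' := fun _ _ hXY _ ⟨ha, b, hb, hba⟩ => ⟨hXY ha, b, hXY hb, hba⟩

theorem prefers_or_prefers (L : PrefList α) {a b : α} (h : a ≠ b) :
    L.Prefers a b ∨ L.Prefers b a :=
  lt_or_gt_of_ne fun hab => h ((List.idxOf_inj (L.complete a)).1 hab)

theorem Prefers.asymm {L : PrefList α} {a b : α} (h : L.Prefers a b) : ¬ L.Prefers b a :=
  lt_asymm h

theorem favorite_eq_some_iff {L : PrefList α} {p : α → Prop} [DecidablePred p] {a : α} :
    L.favorite p = some a ↔ L.IsFavorite {b | p b} a := by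
  simp only [favorite, IsFavorite, Prefers, List.find?_eq_some_iff_getElem, decide_eq_true_eq,
    Bool.not_eq_true', decide_eq_false_iff_not, Set.mem_ofPred_eq]
  refine and_congr_right fun _ => ⟨?_, fun h => ?_⟩
  · rintro ⟨i, hi, rfl, hlt⟩ b hb hba
    rw [L.nodup.idxOf_getElem] at hba
    exact hlt _ hba (by simpa using hb)
  · refine ⟨_, List.idxOf_lt_length_iff.2 (L.complete a), by simp, fun j hj hp => h _ hp ?_⟩
    rwa [L.nodup.idxOf_getElem]

theorem exists_isFavorite (L : PrefList α) {X : Set α} (hX : X.Nonempty) :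
    ∃ a, L.IsFavorite X a :=
  (measure fun a => L.toList.idxOf a).wf.has_min X hX

theorem mem_outranked_iff {L : PrefList α} {X : Set α} {a : α} :
    a ∈ L.outranked X ↔ a ∈ X ∧ ¬ L.IsFavorite X a := by
  refine and_congr_right fun ha => ⟨fun ⟨b, hb, hba⟩ h => h.2 b hb hba, fun h => ?_⟩
  by_contra! hno
  exact h ⟨ha, hno⟩

namespace IsFavorite

variable {L : PrefList α} {X Y : Set α} {a b : α}

theorem of_subset (h : L.IsFavorite X a) (hYX : Y ⊆ X) (ha : a ∈ Y) : L.IsFavorite Y a :=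
  ⟨ha, fun b hb => h.2 b (hYX hb)⟩

theorem notMem_outranked (h : L.IsFavorite X a) : a ∉ L.outranked X :=
  fun ha => (mem_outranked_iff.1 ha).2 h

theorem mem_outranked (h : L.IsFavorite X a) (hb : b ∈ X) (hba : b ≠ a) : b ∈ L.outranked X :=
  ⟨hb, a, h.1, (L.prefers_or_prefers hba).resolve_left (h.2 b hb)⟩

theorem ne_of_mem_outranked (h : L.IsFavorite X a) (hYX : Y ⊆ X) (hb : b ∈ L.outranked Y) :
    b ≠ a := by
  rintro rfl
  exact h.notMem_outranked (L.outranked.monotone hYX hb)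

end IsFavorite

theorem exists_isTopTwo (L : PrefList α) {X : Set α} (hX : X.Nonempty) :
    ∃ p x, L.IsTopTwo X p x ∧ (Nontrivial α → p ≠ x) := by
  obtain ⟨p, hp⟩ := L.exists_isFavorite hX
  by_cases hX' : (X \ {p}).Nonempty
  · obtain ⟨x, hx⟩ := L.exists_isFavorite hX'
    exact ⟨p, x, ⟨hp, fun _ => hx⟩, fun _ => Ne.symm hx.1.2⟩
  · obtain ⟨x, hx⟩ : ∃ x, Nontrivial α → p ≠ x := by
      by_cases hα : Nontrivial α
      · obtain ⟨x, hx⟩ := exists_ne p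
        exact ⟨x, fun _ => hx.symm⟩
      · exact ⟨p, fun h => absurd h hα⟩
    exact ⟨p, x, ⟨hp, fun h => absurd h hX'⟩, hx⟩

/-- The list `(p, q, L \ {p, q})`, which for `p = q` is read as `(p, L \ {p})`; it is the
list that witnesses membership in `topTwoLists L`. -/
def promote (L : PrefList α) (p q : α) : PrefList α where
  toList := [p, q].dedup ++ L.toList.filter (fun m => decide (m ≠ p ∧ m ≠ q))
  nodup := by
    refine (List.nodup_dedup _).append (L.nodup.filter _) fun m hm hm' => ?_
    simp only [List.mem_dedup, List.mem_cons, List.not_mem_nil, or_false] at hm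
    simp only [List.mem_filter, decide_eq_true_eq] at hm'
    tauto
  complete m := by
    have := L.complete m
    simp only [List.mem_append, List.mem_dedup, List.mem_cons, List.not_mem_nil, or_false,
      List.mem_filter, decide_eq_true_eq]
    tauto

theorem isFavorite_promote (L : PrefList α) (p q : α) :
    (L.promote p q).IsFavorite Set.univ p := by
  refine ⟨Set.mem_univ p, fun m _ h => ?_⟩
  by_cases hpq : p = q
  · simp [Prefers, promote, hpq] at h
  · simp [Prefers, promote, List.dedup_cons_of_notMem, hpq] at h

theorem isFavorite_sdiff_promote (L : PrefList α) {p q : α} (hpq : p ≠ q) :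
    (L.promote p q).IsFavorite (Set.univ \ {p}) q := by
  refine ⟨⟨Set.mem_univ q, hpq.symm⟩, fun m hm h => ?_⟩
  simp [Prefers, promote, List.dedup_cons_of_notMem, hpq, List.idxOf_cons_ne, Ne.symm hm.2] at h

theorem isTopTwo_promote (L : PrefList α) {p q : α} (hpq : Nontrivial α → p ≠ q) :
    (L.promote p q).IsTopTwo Set.univ p q :=
  ⟨L.isFavorite_promote p q, fun ⟨m, hm⟩ => L.isFavorite_sdiff_promote (hpq ⟨m, p, hm.2⟩)⟩

end PrefList

/-- How a woman answers a set of proposers: she rejects the men in its image. Monotonicity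
(a rejected man stays rejected when more men propose) is the substitutability condition of
matching theory. -/
abbrev RejectionRule (M : Type*) := Set M →o Set M

/-- The rule of rejecting exactly the proposers in `B`. -/
def RejectionRule.rejectOnly {M : Type*} (B : Set M) : RejectionRule M where
  toFun X := X ∩ B
  monotone' := fun _ _ hXY => Set.inter_subset_inter_left B hXY

theorem RejectionRule.notMem_rejectOnly {M : Type*} {B X : Set M} {m : M} (hm : m ∉ B) :
    m ∉ rejectOnly B X :=
  fun h => hm h.2

namespace DeferredAcceptance

/-- The men who propose to `v` in the set `S` of proposals. -/
def proposers {M W : Type*} (S : Set (M × W)) (v : W) : Set M :=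
  {m | (m, v) ∈ S}

section RejectionRules

variable {M W : Type*} [DecidableEq W]

/-- The proposals `(m, v)` such that all women whom `m` prefers to `v` reject him, given the
proposals `S` and the women's rejection rules `R`. -/
def admissibleProposals (men : M → PrefList W) (R : W → RejectionRule M) :
    Set (M × W) →o Set (M × W) where
  toFun S := {x | ∀ v, (men x.1).Prefers v x.2 → x.1 ∈ R v (proposers S v)}
  monotone' := fun _ _ hST _ hx v hv => (R v).monotone (fun _ hm => hST hm) (hx v hv)

/-- The proposals made in deferred acceptance when the women use the rejection rules `R`. As a
least fixed point it does not depend on the order of the proposals. -/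
def proposals (men : M → PrefList W) (R : W → RejectionRule M) : Set (M × W) :=
  (admissibleProposals men R).lfp

/-- The men whom `v` has not rejected at the end of deferred acceptance with the rules `R`. For
general rules, there may be several of them. -/
def accepted (men : M → PrefList W) (R : W → RejectionRule M) (v : W) : Set M :=
  proposers (proposals men R) v \ R v (proposers (proposals men R) v)

variable {men : M → PrefList W} {R R' : W → RejectionRule M}

theorem admissibleProposals_proposals :
    admissibleProposals men R (proposals men R) = proposals men R :=
  (admissibleProposals men R).map_lfp

theorem rejected_of_prefers {m : M} {v v' : W} (h : (m, v) ∈ proposals men R)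
    (hv' : (men m).Prefers v' v) : m ∈ R v' (proposers (proposals men R) v') :=
  admissibleProposals_proposals.superset h v' hv'

theorem proposals_subset_proposals
    (h : ∀ v, R v (proposers (proposals men R ∩ proposals men R') v) ⊆
      R' v (proposers (proposals men R') v)) :
    proposals men R ⊆ proposals men R' := by
  suffices hclosed : admissibleProposals men R (proposals men R ∩ proposals men R') ⊆
      proposals men R ∩ proposals men R' from
    ((admissibleProposals men R).lfp_le hclosed).trans Set.inter_subset_right
  refine Set.subset_inter ?_ fun x hx => ?_
  · exact ((admissibleProposals men R).monotone Set.inter_subset_left).trans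
      admissibleProposals_proposals.subset
  · exact admissibleProposals_proposals.subset fun v hv => h v (hx v hv)

theorem eq_of_mem_accepted {m : M} {v v' : W} (hv : m ∈ accepted men R v)
    (hv' : m ∈ accepted men R v') : v = v' := by
  by_contra hne
  rcases (men m).prefers_or_prefers hne with hp | hp
  · exact hv.2 (rejected_of_prefers hv'.1 hp)
  · exact hv'.2 (rejected_of_prefers hv.1 hp)

theorem subsingleton_accepted [Finite M] (hcard : Nat.card M ≤ Nat.card W)
    (h : ∀ v, (accepted men R v).Nonempty) (w : W) : (accepted men R w).Subsingleton := by
  choose f hf using h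
  have hinj : Function.Injective f := fun v v' hvv' =>
    eq_of_mem_accepted (hf v) (hvv' ▸ hf v')
  have hsurj : Function.Surjective f := (hinj.bijective_of_nat_card_le hcard).2
  suffices hfw : ∀ m ∈ accepted men R w, m = f w from
    fun m hm m' hm' => (hfw m hm).trans (hfw m' hm').symm
  intro m hm
  obtain ⟨v, rfl⟩ := hsurj m
  rw [eq_of_mem_accepted (hf v) hm]

end RejectionRules

section Profile

variable {M W : Type*} [DecidableEq M] [DecidableEq W]

/-- The rejection rules given by the women's preference lists. -/
def rejectionRules (P : PrefProfile M W) : W → RejectionRule M :=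
  fun v => (P.women v).outranked

/-- The proposals made when `w` uses the rejection rule `ρ` and everybody else acts according to
the profile `P`. -/
def proposalsWith (P : PrefProfile M W) (w : W) (ρ : RejectionRule M) : Set (M × W) :=
  proposals P.men (Function.update (rejectionRules P) w ρ)

/-- The men who propose to `w` when she uses the rejection rule `ρ`. -/
def proposersWith (P : PrefProfile M W) (w : W) (ρ : RejectionRule M) : Set M :=
  proposers (proposalsWith P w ρ) w

variable {P : PrefProfile M W} {w : W}

theorem rejectionRules_replaceWoman (L : PrefList M) :
    rejectionRules (P.replaceWoman w L) = Function.update (rejectionRules P) w L.outranked := by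
  funext v
  by_cases hv : v = w
  · subst hv
    simp [rejectionRules, PrefProfile.replaceWoman]
  · simp [rejectionRules, PrefProfile.replaceWoman, hv]

theorem holds_eq_some_iff {S : Finset (M × W)} {m : M} :
    holds P S w = some m ↔ (P.women w).IsFavorite (proposers S w) m :=
  PrefList.favorite_eq_some_iff

theorem rejected_iff {S : Finset (M × W)} {m : M} :
    Rejected P S m w ↔ m ∈ rejectionRules P w (proposers S w) := by
  rw [Rejected, Ne, holds_eq_some_iff, rejectionRules, PrefList.mem_outranked_iff]
  rfl

end Profile

section Algorithm

variable {M W : Type*} [Fintype M] [Fintype W] [DecidableEq M] [DecidableEq W]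

theorem newProposals_subset_admissibleProposals (P : PrefProfile M W) (S : Finset (M × W)) :
    (newProposals P S : Set (M × W)) ⊆ admissibleProposals P.men (rejectionRules P) S := by
  rintro ⟨m, v⟩ h v' hv'
  have hfav := PrefList.favorite_eq_some_iff.1 (mem_newProposals.1 h).2
  exact rejected_iff.1 (by_contra fun hr => hfav.2 v' hr hv')

theorem proposalsAfter_subset_proposals (P : PrefProfile M W) (k : ℕ) :
    (proposalsAfter P k : Set (M × W)) ⊆ proposals P.men (rejectionRules P) := by
  induction k with
  | zero => simp [proposalsAfter]
  | succ k ih =>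
    rw [proposalsAfter, Finset.coe_union]
    exact Set.union_subset ih <| (newProposals_subset_admissibleProposals P _).trans <|
      ((admissibleProposals _ _).monotone ih).trans admissibleProposals_proposals.subset

theorem proposalsAfter_subset_admissibleProposals (P : PrefProfile M W) (k : ℕ) :
    (proposalsAfter P k : Set (M × W)) ⊆
      admissibleProposals P.men (rejectionRules P) (proposalsAfter P k) := by
  induction k with
  | zero => simp [proposalsAfter]
  | succ k ih =>
    rw [proposalsAfter, Finset.coe_union]
    exact (Set.union_subset ih (newProposals_subset_admissibleProposals P _)).trans
      ((admissibleProposals _ _).monotone Set.subset_union_left)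

theorem admissibleProposals_finalProposals_subset (P : PrefProfile M W) :
    admissibleProposals P.men (rejectionRules P) (finalProposals P) ⊆ finalProposals P := by
  rintro ⟨m, v⟩ h
  by_contra hv
  have hfav : (P.men m).favorite (fun v => ¬ Rejected P (finalProposals P) m v) = some v :=
    PrefList.favorite_eq_some_iff.2
      ⟨fun hr => hv hr.1, fun v' hr hv' => hr (rejected_iff.2 (h v' hv'))⟩
  by_cases hunmatched : Unmatched P (finalProposals P) m
  · have hnew := mem_newProposals.2 ⟨hunmatched, hfav⟩
    simp [newProposals_finalProposals] at hnew
  · obtain ⟨v₀, hv₀⟩ : ∃ v₀, holds P (finalProposals P) v₀ = some m := by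
      simpa [Unmatched] using hunmatched
    have hne : v₀ ≠ v := by
      rintro rfl
      exact hv (mem_of_holds hv₀)
    rcases (P.men m).prefers_or_prefers hne with hp | hp
    · exact (rejected_iff.2 (h v₀ hp)).2 hv₀
    · exact hv (proposalsAfter_subset_admissibleProposals P _ (mem_of_holds hv₀) v hp).1

theorem coe_finalProposals (P : PrefProfile M W) :
    (finalProposals P : Set (M × W)) = proposals P.men (rejectionRules P) :=
  (proposalsAfter_subset_proposals P _).antisymm
    ((admissibleProposals _ _).lfp_le (admissibleProposals_finalProposals_subset P))

theorem coe_finalProposals_replaceWoman (P : PrefProfile M W) (w : W) (L : PrefList M) :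
    (finalProposals (P.replaceWoman w L) : Set (M × W)) = proposalsWith P w L.outranked := by
  rw [coe_finalProposals, rejectionRules_replaceWoman]
  rfl

theorem prefers_partner (hcard : Fintype.card M = Fintype.card W) {P : PrefProfile M W} {m : M}
    {v : W} (h : (m, v) ∈ finalProposals P) (hne : v ≠ partner hcard P m) :
    (P.men m).Prefers v (partner hcard P m) := by
  refine ((P.men m).prefers_or_prefers hne).resolve_right fun hp => ?_
  exact (rejected_iff.2 (proposalsAfter_subset_admissibleProposals P _ h _ hp)).2
    (holds_partner hcard P m)

theorem deferredAcceptance_eq_of_finalProposals_eq (hcard : Fintype.card M = Fintype.card W)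
    {P Q : PrefProfile M W} (hmen : P.men = Q.men) (h : finalProposals P = finalProposals Q) :
    deferredAcceptance hcard P = deferredAcceptance hcard Q := by
  refine Equiv.ext fun m => ?_
  change partner hcard P m = partner hcard Q m
  by_contra hne
  have hP : (m, partner hcard P m) ∈ finalProposals P := mem_of_holds (holds_partner hcard P m)
  have hQ : (m, partner hcard Q m) ∈ finalProposals Q := mem_of_holds (holds_partner hcard Q m)
  have hPQ := prefers_partner hcard (h ▸ hP) hne
  have hQP := prefers_partner hcard (h ▸ hQ) (Ne.symm hne)
  exact hPQ.asymm (hmen ▸ hQP)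

theorem nonempty_proposers_proposalsWith (hcard : Fintype.card M = Fintype.card W)
    (P : PrefProfile M W) (w : W) (L : PrefList M) (v : W) :
    (proposers (proposalsWith P w L.outranked) v).Nonempty := by
  obtain ⟨m, rfl⟩ := (partner_bijective hcard (P.replaceWoman w L)).2 v
  rw [← coe_finalProposals_replaceWoman]
  exact ⟨m, mem_of_holds (holds_partner hcard _ m)⟩

end Algorithm

section Misreport

variable {M W : Type*} [DecidableEq M] [DecidableEq W] {P : PrefProfile M W} {w : W}
  {L L' : PrefList M} {p x : M}

theorem proposalsWith_subset_proposalsWith {ρ ρ' : RejectionRule M}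
    (h : ρ (proposersWith P w ρ ∩ proposersWith P w ρ') ⊆ ρ' (proposersWith P w ρ')) :
    proposalsWith P w ρ ⊆ proposalsWith P w ρ' := by
  refine proposals_subset_proposals fun v => ?_
  by_cases hv : v = w
  · subst hv
    rwa [Function.update_self, Function.update_self]
  · simp only [Function.update_of_ne hv]
    exact (rejectionRules P v).monotone fun _ hm => hm.2

theorem proposalsWith_subset_of_isFavorite
    (hL' : L'.IsFavorite (proposersWith P w L'.outranked) p) (hL : L.IsFavorite Set.univ p) :
    proposalsWith P w L.outranked ⊆ proposalsWith P w L'.outranked :=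
  proposalsWith_subset_proposalsWith fun _ hm =>
    hL'.mem_outranked hm.1.2 (hL.ne_of_mem_outranked (Set.subset_univ _) hm)

theorem subset_proposalsWith_of_mem_or_mem
    (hL' : L'.IsTopTwo (proposersWith P w L'.outranked) p x) (hL : L.IsTopTwo Set.univ p x)
    (hpx : p ∈ proposersWith P w L.outranked ∨ x ∈ proposersWith P w L.outranked) :
    proposalsWith P w L'.outranked ⊆ proposalsWith P w L.outranked := by
  refine proposalsWith_subset_proposalsWith fun m hm => ?_
  have hmp : m ≠ p := hL'.1.ne_of_mem_outranked Set.inter_subset_left hm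
  by_cases hp : p ∈ proposersWith P w L.outranked
  · exact (hL.1.of_subset (Set.subset_univ _) hp).mem_outranked hm.1.2 hmp
  · have hmx : m ≠ x := (hL'.2 ⟨m, hm.1.1, hmp⟩).ne_of_mem_outranked
      (Set.subset_sdiff_singleton Set.inter_subset_left fun h => hp h.2) hm
    have hx : L.IsFavorite (proposersWith P w L.outranked) x :=
      (hL.2 ⟨m, Set.mem_univ m, hmp⟩).of_subset
        (Set.subset_sdiff_singleton (Set.subset_univ _) hp) (hpx.resolve_left hp)
    exact hx.mem_outranked hm.1.2 hmx

theorem mem_proposersWith_rejectOnly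
    (hp : L.IsFavorite (proposersWith P w L.outranked) p)
    (hx : L.IsFavorite (proposersWith P w L.outranked \ {p}) x) :
    p ∈ proposersWith P w (.rejectOnly (proposersWith P w L.outranked \ {p, x})) ∧
      x ∈ proposersWith P w (.rejectOnly (proposersWith P w L.outranked \ {p, x})) := by
  by_contra hnot
  suffices hsub : proposalsWith P w L.outranked ⊆
      proposalsWith P w (.rejectOnly (proposersWith P w L.outranked \ {p, x})) from
    hnot ⟨hsub hp.1, hsub hx.1.1⟩
  refine proposalsWith_subset_proposalsWith fun m hm => ⟨hm.1.2, hm.1.1, ?_⟩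
  have hmp : m ≠ p := hp.ne_of_mem_outranked Set.inter_subset_left hm
  rintro (rfl | rfl)
  · exact hmp rfl
  · exact hx.ne_of_mem_outranked
      (Set.subset_sdiff_singleton Set.inter_subset_left fun h => hnot ⟨h.2, hm.1.2⟩) hm rfl

theorem exists_proposers_proposalsWith_rejectOnly_eq_empty [Finite M]
    (hcard : Nat.card M ≤ Nat.card W) {B : Set M} (hpx : p ≠ x) (hpB : p ∉ B) (hxB : x ∉ B)
    (hp : p ∈ proposersWith P w (.rejectOnly B)) (hx : x ∈ proposersWith P w (.rejectOnly B)) :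
    ∃ v, proposers (proposalsWith P w (.rejectOnly B)) v = ∅ := by
  by_contra! hne
  have hacc : ∀ m ∈ proposersWith P w (.rejectOnly B), m ∉ B →
      m ∈ accepted P.men (Function.update (rejectionRules P) w (.rejectOnly B)) w := by
    intro m hm hmB
    rw [accepted, Function.update_self]
    exact ⟨hm, RejectionRule.notMem_rejectOnly hmB⟩
  refine hpx (subsingleton_accepted hcard (fun v => ?_) w (hacc p hp hpB) (hacc x hx hxB))
  by_cases hv : v = w
  · subst hv
    exact ⟨p, hacc p hp hpB⟩
  · obtain ⟨m, hm⟩ := (P.women v).exists_isFavorite (hne v)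
    rw [accepted, Function.update_of_ne hv]
    exact ⟨m, hm.1, hm.notMem_outranked⟩

end Misreport

section TopTwo

variable {M W : Type*} [Fintype M] [Fintype W] [DecidableEq M] [DecidableEq W]
  {P : PrefProfile M W} {w : W} {L L' : PrefList M} {p x : M}

theorem mem_proposersWith_or_mem_proposersWith (hcard : Fintype.card M = Fintype.card W)
    (hL' : L'.IsTopTwo (proposersWith P w L'.outranked) p x) (hL : L.IsFavorite Set.univ p) :
    p ∈ proposersWith P w L.outranked ∨ x ∈ proposersWith P w L.outranked := by
  by_contra! hpx
  have hsub := proposalsWith_subset_of_isFavorite hL'.1 hL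
  have hx : L'.IsFavorite (proposersWith P w L'.outranked \ {p}) x := by
    obtain ⟨m, hm⟩ := nonempty_proposers_proposalsWith hcard P w L w
    exact hL'.2 ⟨m, hsub hm, ne_of_mem_of_not_mem hm hpx.1⟩
  have hmem := mem_proposersWith_rejectOnly hL'.1 hx
  have hcard' : Nat.card M ≤ Nat.card W := by simp [hcard]
  obtain ⟨v, hv⟩ := exists_proposers_proposalsWith_rejectOnly_eq_empty hcard' (Ne.symm hx.1.2)
    (by simp) (by simp) hmem.1 hmem.2
  have hsub' : proposalsWith P w L.outranked ⊆
      proposalsWith P w (.rejectOnly (proposersWith P w L'.outranked \ {p, x})) := by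
    refine proposalsWith_subset_proposalsWith fun m hm => ⟨hm.1.2, hsub hm.1.1, ?_⟩
    rintro (rfl | rfl)
    exacts [hpx.1 hm.1.1, hpx.2 hm.1.1]
  obtain ⟨m, hm⟩ := nonempty_proposers_proposalsWith hcard P w L v
  exact hv.subset (hsub' hm)

theorem proposalsWith_eq_of_isTopTwo (hcard : Fintype.card M = Fintype.card W)
    (hL' : L'.IsTopTwo (proposersWith P w L'.outranked) p x) (hL : L.IsTopTwo Set.univ p x) :
    proposalsWith P w L.outranked = proposalsWith P w L'.outranked :=
  (proposalsWith_subset_of_isFavorite hL'.1 hL.1).antisymm <|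
    subset_proposalsWith_of_mem_or_mem hL' hL
      (mem_proposersWith_or_mem_proposersWith hcard hL' hL.1)

end TopTwo

end DeferredAcceptance

open DeferredAcceptance in
theorem mainTheorem8 {M W : Type*} [Fintype M] [Fintype W] [DecidableEq M] [DecidableEq W]
    (hcard : Fintype.card M = Fintype.card W) (P : PrefProfile M W) (w : W) (L' : PrefList M) :
    ∃ L'' ∈ topTwoLists (P.women w),
      deferredAcceptance hcard (P.replaceWoman w L'') =
        deferredAcceptance hcard (P.replaceWoman w L') := by
  obtain ⟨p, x, hL', hpx⟩ :=
    L'.exists_isTopTwo (nonempty_proposers_proposalsWith hcard P w L' w)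
  have hL'' := (P.women w).isTopTwo_promote hpx
  refine ⟨(P.women w).promote p x,
    ⟨p, x, fun h => hpx (Fintype.one_lt_card_iff_nontrivial.1 h), rfl⟩, ?_⟩
  refine deferredAcceptance_eq_of_finalProposals_eq hcard rfl (Finset.coe_injective ?_)
  simp only [coe_finalProposals_replaceWoman]
  exact proposalsWith_eq_of_isTopTwo hcard hL' hL''
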